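/- Let $L=(X,<)$ be a planar lattice, i.e. a finite lattice given with a fixed ordered realizer $[L_1,L_2]$: $L_1,L_2$ are linear orders on $X$ with $L=L_1\cap L_2$. For incomparable $x,y\in X$, say that $x$ is left of $y$ if $x<y$ in $L_1$ and $y<x$ in $L_2$; this relation is the strict order of the primary conjugate $Q$, with realizer $[L_1,\overline{L_2}]$, and it fixes a plane embedding of the diagram (Hasse diagram) $D_L$ of $L$. The left boundary chain of $D_L$ consists of the elements that have no element to their left. The canonical chain partition $C_1,C_2,\dots,C_w$ of $L$ is obtained by recursively removing all minimal elements of $Q$: $C_j$ is the set of minimal elements, in $Q$, of $X\setminus(C_1\cup\dots\cup C_{j-1})$. Let $h:X\to\mathbb{R}$ be an extension of $L$, i.e. $x<y$ in $L$ implies $h(x)<h(y)$ (incomparable elements may have equal values). Then $D_L$ has a plane straight-line drawing $\Gamma$ such that each $x\in X$ is represented by a point with $y$-coordinate $h(x)$. That is, the elements are represented by distinct points, each cover relation $x\prec y$ by the straight segment, going upwards, between the points of $x$ and $y$, no segment contains the point of an element other than its two ends, and two different segments meet only in common endpoints. Moreover $\Gamma$ has the plane embedding fixed by the realizer: at each element,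 the edges to its upper covers and the edges to its lower covers leave in the left-to-right order of these covers. Additionally, all elements of the left boundary chain of $D_L$ lie on a single vertical line of $\Gamma$. The drawing proceeds chain by chain along the canonical chain partition: there are reals $\xi_1<\xi_2<\dots<\xi_w$ such that all elements of $C_i$ are drawn on the vertical line $x=\xi_i$, and for each $i$ the points of the elements of $C_1\cup\dots\cup C_i$ give a plane straight-line drawing of the diagram of the suborder of $L$ induced by these elements. -/

import Mathlib

/-- An ordered realizer `[L₁, L₂]` of a partial order: an ordered pair of (strict) linear orders
whose intersection is the order of `X`. -/
structure OrderedRealizer (X : Type*) [PartialOrder X] where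
  lt₁ : X → X → Prop
  lt₂ : X → X → Prop
  isStrictTotalOrder₁ : IsStrictTotalOrder X lt₁
  isStrictTotalOrder₂ : IsStrictTotalOrder X lt₂
  lt_iff : ∀ x y : X, x < y ↔ lt₁ x y ∧ lt₂ x y

namespace OrderedRealizer

variable {X : Type*} [PartialOrder X]

/-- The strict order of the primary conjugate `Q`, the poset on `X` with realizer
`[L₁, reverse of L₂]`. -/
def conjLT (R : OrderedRealizer X) (x y : X) : Prop :=
  R.lt₁ x y ∧ R.lt₂ y x

/-- `x` is (strictly) left of `y`: they are incomparable, and `x` is below `y` in the primary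
conjugate. -/
def IsLeftOf (R : OrderedRealizer X) (x y : X) : Prop :=
  ¬ x ≤ y ∧ ¬ y ≤ x ∧ R.conjLT x y

/-- The left boundary chain of the plane diagram fixed by the realizer: the elements that have no
element to their left. -/
def leftBoundary (R : OrderedRealizer X) : Set X :=
  {x | ∀ y : X, ¬ R.IsLeftOf y x}

end OrderedRealizer

/-- The minimal elements, with respect to a strict order `r`, of a set `S`. -/
def minimalElements {X : Type*} (r : X → X → Prop) (S : Set X) : Set X :=
  {x | x ∈ S ∧ ∀ y ∈ S, ¬ r y x}

/-- The union of the first `n` antichains of the canonical antichain partition of the strict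
order `r`, which is obtained by recursively removing all minimal elements. -/
def firstAntichains {X : Type*} (r : X → X → Prop) : ℕ → Set X
  | 0 => ∅
  | n + 1 => firstAntichains r n ∪ minimalElements r (firstAntichains r n)ᶜ

/-- The antichain with index `n` (counted from `0`) of the canonical antichain partition of the
strict order `r`; it is empty once all elements have been removed. -/
def canonicalAntichain {X : Type*} (r : X → X → Prop) (n : ℕ) : Set X :=
  minimalElements r (firstAntichains r n)ᶜ

namespace OrderedRealizer

variable {X : Type*} [PartialOrder X]

/-- The chain with index `n` (counted from `0`) of the canonical chain partition: the
corresponding antichain of the canonical antichain partition of the primary conjugate. -/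
def canonicalChain (R : OrderedRealizer X) (n : ℕ) : Set X :=
  canonicalAntichain R.conjLT n

end OrderedRealizer

/-- `pos` gives a plane straight-line drawing of the diagram of `X`: elements are distinct points,
each cover relation `x ⋖ y` is drawn as the segment from `pos x` to `pos y`, which goes upwards,
edges contain no elements but their endpoints, and two different edges meet only in the points of
their common endpoints. -/
structure IsPlaneStraightLineDiagram {X : Type*} [PartialOrder X] (pos : X → ℝ × ℝ) : Prop where
  injective : Function.Injective pos
  upward : ∀ x y : X, x ⋖ y → (pos x).2 < (pos y).2
  vertex_on_edge : ∀ x y z : X, x ⋖ y → pos z ∈ segment ℝ (pos x) (pos y) → z = x ∨ z = y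
  noncrossing : ∀ a b c d : X, a ⋖ b → c ⋖ d → (a, b) ≠ (c, d) →
    segment ℝ (pos a) (pos b) ∩ segment ℝ (pos c) (pos d) ⊆ pos '' ({a, b} ∩ {c, d})

/-- The drawing `pos` has the plane embedding fixed by the realizer: at each element `x`, the
edges going up to its upper covers, and the edges going down to its lower covers, leave `x` in the
left-to-right order given by the left-of relation. (As the edges go upwards, the inequalities
compare the horizontal displacements of the two edges per unit of height.) -/
structure RespectsEmbedding {X : Type*} [PartialOrder X] (R : OrderedRealizer X)
    (pos : X → ℝ × ℝ) : Prop where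
  upper : ∀ x y z : X, x ⋖ y → x ⋖ z → R.IsLeftOf y z →
    ((pos y).1 - (pos x).1) * ((pos z).2 - (pos x).2) <
      ((pos z).1 - (pos x).1) * ((pos y).2 - (pos x).2)
  lower : ∀ x y z : X, y ⋖ x → z ⋖ x → R.IsLeftOf y z →
    ((pos y).1 - (pos x).1) * ((pos x).2 - (pos z).2) <
      ((pos z).1 - (pos x).1) * ((pos x).2 - (pos y).2)

/-!
The drawing is explicit: an element `x` of the canonical chain with index `n` is drawn at
`(K ^ n, h x)`, for a single real number `K` that is large compared with all the ratios
`(h u - h v) / (h y - h x)`, `x < y`. An edge whose end `u` lies on an earlier chain than its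
end `v` is then almost horizontal up to the last chain line before that of `v`: on these lines its
height differs from `h u` by at most a third of every gap `h y - h x`, `x < y`. So the position of
such an edge relative to the drawn elements, and to the other edges, is decided by the order
relations of its left end `u`, and the drawing is plane as soon as these relations are consistent.

They are, because `X` is a lattice. The main point is `not_conjLT_of_edge`: if `u` and `v` are
joined by an edge and `u` lies on an earlier chain, then no element of a chain before that of `v`
is to the right of `u`. For if `v ⋖ u` and `y` were such an element, an element `w` to the left of
`v` on the chain just before that of `v` would be below both `u` and `y`, hence below
`u ⊓ y = v`. As a consequence `u` is comparable to all elements of the chains between its own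
and that of `v` (`lt_or_lt_of_edge`), and left ends of edges that cross the same vertical strip are
comparable. The lemmas `le_of_edge_of_edge` and `edge_above_or_below` then say that two edges
come in the same vertical order at both ends of their common range, so that two affine functions
are to be compared at two points only.

Finally, covers in the suborder formed by the first chains are covers in `X`
(`covBy_of_covBy_initial`), so that the drawings of these suborders are parts of the whole
drawing.
-/

/-! ### The canonical antichain partition -/

section Antichains

variable {X : Type*} {r : X → X → Prop}

theorem firstAntichains_mono : Monotone (firstAntichains r) :=
  monotone_nat_of_le_succ fun _ => Set.subset_union_left

theorem exists_mem_firstAntichains [Finite X] [IsStrictOrder X r] (x : X) :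
    ∃ n, x ∈ firstAntichains r (n + 1) := by
  have wf : WellFounded r := Finite.wellFounded_of_trans_of_irrefl r
  induction x using wf.induction with
  | _ x ih =>
    choose f hf using ih
    obtain ⟨N, hN⟩ := (Set.finite_range fun y : {y // r y x} => f y.1 y.2).bddAbove
    refine ⟨N + 1, ?_⟩
    by_cases hx : x ∈ firstAntichains r (N + 1)
    · exact Or.inl hx
    · refine Or.inr ⟨hx, fun y hy hyx => hy ?_⟩
      have hle : f y hyx ≤ N := hN ⟨⟨y, hyx⟩, rfl⟩
      exact firstAntichains_mono (Nat.succ_le_succ hle) (hf y hyx)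

/-- The index of the antichain of the canonical antichain partition that contains `x`. -/
noncomputable def antichainIndex (r : X → X → Prop) (x : X) : ℕ :=
  sInf {n | x ∈ firstAntichains r (n + 1)}

variable [Finite X] [IsStrictOrder X r]

theorem mem_firstAntichains_iff {x : X} {n : ℕ} :
    x ∈ firstAntichains r n ↔ antichainIndex r x < n := by
  constructor
  · intro hx
    cases n with
    | zero => exact hx.elim
    | succ n => exact Nat.lt_succ_of_le (Nat.sInf_le hx)
  · intro hn
    exact firstAntichains_mono hn (Nat.sInf_mem (exists_mem_firstAntichains (r := r) x))

theorem mem_canonicalAntichain_iff {x : X} {n : ℕ} :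
    x ∈ canonicalAntichain r n ↔ antichainIndex r x = n := by
  constructor
  · intro hx
    have h1 : x ∈ firstAntichains r (n + 1) := Or.inr hx
    have h2 : x ∉ firstAntichains r n := hx.1
    rw [mem_firstAntichains_iff] at h1 h2
    omega
  · intro hx
    have h1 : x ∈ firstAntichains r (n + 1) := by rw [mem_firstAntichains_iff]; omega
    have h2 : x ∉ firstAntichains r n := by rw [mem_firstAntichains_iff]; omega
    exact h1.resolve_left h2

theorem antichainIndex_lt {x y : X} (hxy : r x y) : antichainIndex r x < antichainIndex r y := by
  have hy : y ∈ canonicalAntichain r (antichainIndex r y) := mem_canonicalAntichain_iff.2 rfl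
  by_contra hx
  exact hy.2 x (fun hx' => hx (mem_firstAntichains_iff.1 hx')) hxy

theorem exists_antichainIndex_eq {z : X} {n : ℕ} (hn : n < antichainIndex r z) :
    ∃ w, r w z ∧ antichainIndex r w = n := by
  have wf : WellFounded r := Finite.wellFounded_of_trans_of_irrefl r
  have hz : z ∉ firstAntichains r n := by rw [mem_firstAntichains_iff]; omega
  have hz' : z ∉ canonicalAntichain r n := by rw [mem_canonicalAntichain_iff]; omega
  have hne : {w | w ∉ firstAntichains r n ∧ r w z}.Nonempty := by
    by_contra hemp
    exact hz' ⟨hz, fun y hy hyz => hemp ⟨y, hy, hyz⟩⟩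
  obtain ⟨w, ⟨hw, hwz⟩, hmin⟩ := wf.has_min _ hne
  exact ⟨w, hwz, mem_canonicalAntichain_iff.1
    ⟨hw, fun y hy hyw => hmin y ⟨hy, _root_.trans hyw hwz⟩ hyw⟩⟩

end Antichains

namespace OrderedRealizer

/-! ### The left-to-right order and the canonical chains -/

section Conjugate

variable {X : Type*} [PartialOrder X] (R : OrderedRealizer X)

theorem lt_or_conjLT_of_lt₁ {x y : X} (hxy : R.lt₁ x y) : x < y ∨ R.conjLT x y := by
  have := R.isStrictTotalOrder₁
  have := R.isStrictTotalOrder₂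
  rcases trichotomous_of R.lt₂ x y with h | h | h
  · exact Or.inl ((R.lt_iff x y).2 ⟨hxy, h⟩)
  · exact (irrefl_of R.lt₁ x (h ▸ hxy)).elim
  · exact Or.inr ⟨hxy, h⟩

theorem lt_or_conjLT_of_lt₂ {x y : X} (hxy : R.lt₂ x y) : x < y ∨ R.conjLT y x := by
  have := R.isStrictTotalOrder₁
  have := R.isStrictTotalOrder₂
  rcases trichotomous_of R.lt₁ x y with h | h | h
  · exact Or.inl ((R.lt_iff x y).2 ⟨h, hxy⟩)
  · exact (irrefl_of R.lt₂ x (h ▸ hxy)).elim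
  · exact Or.inr ⟨h, hxy⟩

instance isStrictOrder_conjLT : IsStrictOrder X R.conjLT where
  irrefl x hx := by
    have := R.isStrictTotalOrder₁
    exact irrefl_of R.lt₁ x hx.1
  trans x y z hxy hyz := by
    have := R.isStrictTotalOrder₁
    have := R.isStrictTotalOrder₂
    exact ⟨trans_of R.lt₁ hxy.1 hyz.1, trans_of R.lt₂ hyz.2 hxy.2⟩

theorem trichotomy (x y : X) : x = y ∨ x < y ∨ y < x ∨ R.conjLT x y ∨ R.conjLT y x := by
  have := R.isStrictTotalOrder₁
  rcases trichotomous_of R.lt₁ x y with h | h | h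
  · have := R.lt_or_conjLT_of_lt₁ h
    tauto
  · exact Or.inl h
  · have := R.lt_or_conjLT_of_lt₁ h
    tauto

variable {R}

theorem not_lt_of_conjLT {x y : X} (hxy : R.conjLT x y) : ¬ x < y := by
  have := R.isStrictTotalOrder₂
  exact fun h => asymm_of R.lt₂ hxy.2 ((R.lt_iff x y).1 h).2

theorem not_gt_of_conjLT {x y : X} (hxy : R.conjLT x y) : ¬ y < x := by
  have := R.isStrictTotalOrder₁
  exact fun h => asymm_of R.lt₁ hxy.1 ((R.lt_iff y x).1 h).1

theorem ne_of_conjLT {x y : X} (hxy : R.conjLT x y) : x ≠ y := by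
  rintro rfl
  exact irrefl_of R.conjLT x hxy

theorem isLeftOf_of_conjLT {x y : X} (hxy : R.conjLT x y) : R.IsLeftOf x y :=
  ⟨fun h => not_lt_of_conjLT hxy (lt_of_le_of_ne h (ne_of_conjLT hxy)),
    fun h => not_gt_of_conjLT hxy (lt_of_le_of_ne h (ne_of_conjLT hxy).symm), hxy⟩

theorem lt_or_conjLT_of_conjLT_of_lt {w z y : X} (hw : R.conjLT w z) (hz : z < y) :
    w < y ∨ R.conjLT w y := by
  have := R.isStrictTotalOrder₁
  exact R.lt_or_conjLT_of_lt₁ (trans_of R.lt₁ hw.1 ((R.lt_iff z y).1 hz).1)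

theorem lt_or_conjLT_of_conjLT_of_gt {w z y : X} (hw : R.conjLT w z) (hz : y < z) :
    y < w ∨ R.conjLT w y := by
  have := R.isStrictTotalOrder₂
  exact R.lt_or_conjLT_of_lt₂ (trans_of R.lt₂ ((R.lt_iff y z).1 hz).2 hw.2)

theorem lt_or_conjLT_of_lt_of_conjLT {z u y : X} (hz : z < u) (hu : R.conjLT u y) :
    z < y ∨ R.conjLT z y := by
  have := R.isStrictTotalOrder₁
  exact R.lt_or_conjLT_of_lt₁ (trans_of R.lt₁ ((R.lt_iff z u).1 hz).1 hu.1)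

theorem lt_or_conjLT_of_gt_of_conjLT {z u y : X} (hz : u < z) (hu : R.conjLT u y) :
    y < z ∨ R.conjLT z y := by
  have := R.isStrictTotalOrder₂
  exact R.lt_or_conjLT_of_lt₂ (trans_of R.lt₂ hu.2 ((R.lt_iff u z).1 hz).2)

variable (R)

/-- The index of the canonical chain that contains `x`. -/
noncomputable def level (x : X) : ℕ :=
  antichainIndex R.conjLT x

variable [Finite X]

theorem mem_canonicalChain_iff {x : X} {n : ℕ} : x ∈ R.canonicalChain n ↔ R.level x = n :=
  mem_canonicalAntichain_iff

variable {R}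

theorem level_lt {x y : X} (hxy : R.conjLT x y) : R.level x < R.level y :=
  antichainIndex_lt hxy

theorem exists_level_eq {z : X} {n : ℕ} (hn : n < R.level z) :
    ∃ w, R.conjLT w z ∧ R.level w = n :=
  exists_antichainIndex_eq hn

theorem eq_or_lt_or_lt_of_level_eq {x y : X} (hxy : R.level x = R.level y) :
    x = y ∨ x < y ∨ y < x := by
  rcases R.trichotomy x y with h | h | h | h | h
  · exact Or.inl h
  · exact Or.inr (Or.inl h)
  · exact Or.inr (Or.inr h)
  · exact (hxy.not_lt (level_lt h)).elim
  · exact (hxy.not_gt (level_lt h)).elim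

theorem level_eq_zero_of_mem_leftBoundary {x : X} (hx : x ∈ R.leftBoundary) :
    R.level x = 0 := by
  by_contra h0
  obtain ⟨w, hw, -⟩ := exists_level_eq (R := R) (Nat.pos_of_ne_zero h0)
  exact hx w (isLeftOf_of_conjLT hw)

/-- An element strictly between `a` and `b` on a late chain has an element to its left on the
last of the first `n` chains, and the latter is also between `a` and `b`. -/
theorem covBy_of_covBy_initial {n : ℕ} {s : Set X} (hs : ∀ x, x ∈ s ↔ R.level x < n)
    {a b : s} (hab : a ⋖ b) : (a : X) ⋖ (b : X) := by
  refine ⟨hab.1, fun z haz hzb => ?_⟩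
  have ha := (hs a).1 a.2
  have hb := (hs b).1 b.2
  by_cases hz : R.level z < n
  · exact hab.2 (c := ⟨z, (hs z).2 hz⟩) haz hzb
  · obtain ⟨w, hwz, hw⟩ := exists_level_eq (R := R) (z := z) (n := n - 1) (by omega)
    have hwb : w < b := (lt_or_conjLT_of_conjLT_of_lt hwz hzb).resolve_right fun h => by
      have := level_lt h
      omega
    have haw : a < w := (lt_or_conjLT_of_conjLT_of_gt hwz haz).resolve_right fun h => by
      have := level_lt h
      omega
    exact hab.2 (c := ⟨w, (hs w).2 (by omega)⟩) haw hwb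

end Conjugate

/-! ### Edges between different canonical chains -/

section Edges

variable {X : Type*} [Lattice X] [Finite X] {R : OrderedRealizer X}

/-- The left end of an edge has nothing to its right among the chains before that of the right
end. -/
theorem not_conjLT_of_edge {u v y : X} (huv : u ⋖ v ∨ v ⋖ u) (hl : R.level u < R.level v)
    (hy : R.level y < R.level v) : ¬ R.conjLT u y := by
  intro huy
  obtain ⟨w, hwv, hw⟩ := exists_level_eq (R := R) (z := v) (n := R.level v - 1) (by omega)
  have hnot : ∀ t, R.level t < R.level v → ¬ R.conjLT w t := fun t ht h => by
    have := level_lt h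
    omega
  have hvy : ¬ R.conjLT v y := fun h => by
    have := level_lt h
    omega
  rcases huv with huv | hvu
  · have h1 : y < v := (lt_or_conjLT_of_gt_of_conjLT huv.1 huy).resolve_right hvy
    have h2 : u < w := (lt_or_conjLT_of_conjLT_of_gt hwv huv.1).resolve_right (hnot u hl)
    have h3 : y < w := (lt_or_conjLT_of_conjLT_of_gt hwv h1).resolve_right (hnot y hy)
    rcases huv.eq_or_eq le_sup_left (sup_le huv.1.le h1.le) with h | h
    · exact (isLeftOf_of_conjLT huy).2.1 (sup_eq_left.1 h)
    · exact (isLeftOf_of_conjLT hwv).2.1 (h ▸ sup_le h2.le h3.le)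
  · have h1 : v < y := (lt_or_conjLT_of_lt_of_conjLT hvu.1 huy).resolve_right hvy
    have h2 : w < u := (lt_or_conjLT_of_conjLT_of_lt hwv hvu.1).resolve_right (hnot u hl)
    have h3 : w < y := (lt_or_conjLT_of_conjLT_of_lt hwv h1).resolve_right (hnot y hy)
    rcases hvu.eq_or_eq (le_inf hvu.1.le h1.le) inf_le_left with h | h
    · exact (isLeftOf_of_conjLT hwv).1 (h ▸ le_inf h2.le h3.le)
    · exact (isLeftOf_of_conjLT huy).1 (inf_eq_left.1 h)

/-- The left end of an edge is comparable to all elements of the chains that the edge passes. -/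
theorem lt_or_lt_of_edge {u v z : X} (huv : u ⋖ v ∨ v ⋖ u) (h1 : R.level u ≤ R.level z)
    (h2 : R.level z < R.level v) : z = u ∨ z < u ∨ u < z := by
  rcases R.trichotomy z u with h | h | h | h | h
  · exact Or.inl h
  · exact Or.inr (Or.inl h)
  · exact Or.inr (Or.inr h)
  · have := level_lt h
    omega
  · exact (not_conjLT_of_edge huv (h1.trans_lt h2) h2 h).elim

/-- The left ends of two edges that cross a common vertical strip are comparable. -/
theorem lt_or_lt_of_edge_of_edge {u v u' v' : X} (huv : u ⋖ v ∨ v ⋖ u) (huv' : u' ⋖ v' ∨ v' ⋖ u')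
    (h2 : R.level u' < R.level v) (h3 : R.level u < R.level v') : u = u' ∨ u < u' ∨ u' < u := by
  rcases le_total (R.level u) (R.level u') with h | h
  · have := lt_or_lt_of_edge huv h h2
    tauto
  · have := lt_or_lt_of_edge huv' h h3
    tauto

/-- Edges with their right ends on the same chain have their left ends in the same order as their
right ends. -/
theorem le_of_edge_of_edge {u v u' v' : X} (huv : u ⋖ v ∨ v ⋖ u) (huv' : u' ⋖ v' ∨ v' ⋖ u')
    (h1 : R.level u < R.level v) (h2 : R.level u' < R.level v')
    (h3 : R.level v = R.level v') (hv : v < v') : u ≤ u' := by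
  rcases lt_or_lt_of_edge_of_edge huv huv' (h3 ▸ h2) (h3 ▸ h1) with h | h | h
  · exact h.le
  · exact h.le
  rcases huv with huv | huv <;> rcases huv' with huv' | huv'
  · exact (huv'.2 h (huv.1.trans hv)).elim
  · exact ((huv'.1.trans (h.trans huv.1)).not_gt hv).elim
  · -- here `v` and `u'` are below both `u` and `v'`, so that `v ⊔ u'` is one of `v` and `u`
    rcases huv.eq_or_eq (c := v ⊔ u') le_sup_left (sup_le huv.1.le h.le) with h' | h'
    · have hne : u' ≠ v := fun h => by
        rw [h] at h2
        omega
      exact (huv'.2 (lt_of_le_of_ne (sup_eq_left.1 h') hne) hv).elim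
    · have hne : u ≠ v' := fun h => by
        rw [h] at h1
        omega
      have hle : u ≤ v' := h' ▸ sup_le hv.le huv'.1.le
      exact (huv'.2 h (lt_of_le_of_ne hle hne)).elim
  · exact (huv.2 (hv.trans huv'.1) h).elim

/-- If the edge `u'`, `v'` passes over the line of the right end `v` of the edge `u`, `v`, then
`u'` is comparable to `v`, and its relation to `u` agrees with its relation to `v`. -/
theorem edge_above_or_below {u v u' v' : X} (huv : u ⋖ v ∨ v ⋖ u) (huv' : u' ⋖ v' ∨ v' ⋖ u')
    (h1 : R.level u < R.level v) (h2 : R.level v < R.level v')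
    (h3 : R.level u' < R.level v) : v < u' ∧ u ≤ u' ∨ u' < v ∧ u' ≤ u := by
  have huu := lt_or_lt_of_edge_of_edge huv huv' h3 (h1.trans h2)
  rcases lt_or_lt_of_edge huv' h3.le h2 with h | h | h
  · rw [h] at h3
    omega
  · refine Or.inl ⟨h, ?_⟩
    rcases huu with h' | h' | h'
    · exact h'.le
    · exact h'.le
    · rcases huv with huv | huv
      · exact (huv.1.trans h).le
      · exact (huv.2 h h').elim
  · refine Or.inr ⟨h, ?_⟩
    rcases huu with h' | h' | h'
    · exact h'.ge
    · rcases huv with huv | huv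
      · exact (huv.2 h' h).elim
      · exact (h.trans huv.1).le
    · exact h'.le

end Edges

/-! ### Heights of edges in the drawing -/

/-- The drawing: the chain with index `n` lies on the vertical line with abscissa `K ^ n`. -/
noncomputable def chainPos {X : Type*} [PartialOrder X] (R : OrderedRealizer X) (h : X → ℝ) (K : ℝ)
    (x : X) : ℝ × ℝ :=
  (K ^ R.level x, h x)

/-- The height at the abscissa `t` of the line through the points of `u` and `v`; it is meaningful
only if these points have different abscissae. -/
noncomputable def edgeHeight {X : Type*} [PartialOrder X] (R : OrderedRealizer X) (h : X → ℝ)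
    (K : ℝ) (u v : X) (t : ℝ) : ℝ :=
  h u + (t - K ^ R.level u) * ((h v - h u) / (K ^ R.level v - K ^ R.level u))

/-- Two affine functions that are in the same order at both ends of an interval, strictly at the
right end, agree at most at the left end. -/
theorem eq_left_of_affine_eq {f g : ℝ → ℝ} {a b c d p q : ℝ}
    (hf : ∀ t, f t = a + (t - p) * b) (hg : ∀ t, g t = c + (t - q) * d) {s t x : ℝ}
    (hs : s ≤ x) (ht : x ≤ t) (h1 : f s ≤ g s) (h2 : f t < g t) (hx : f x = g x) : x = s := by
  by_contra hne
  have hsx : s < x := lt_of_le_of_ne hs (Ne.symm hne)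
  have key : (g x - f x) * (t - s) = (g s - f s) * (t - x) + (g t - f t) * (x - s) := by
    simp only [hf, hg]
    ring
  have h3 : 0 < (g t - f t) * (x - s) := mul_pos (sub_pos.2 h2) (sub_pos.2 hsx)
  have h4 : 0 ≤ (g s - f s) * (t - x) := mul_nonneg (sub_nonneg.2 h1) (sub_nonneg.2 ht)
  rw [hx, sub_self, zero_mul] at key
  linarith

theorem mul_pow_sub_pow_le {K : ℝ} (hK : 1 < K) {l j m : ℕ} (hjm : j < m) :
    K * (K ^ j - K ^ l) ≤ K ^ m - K ^ l := by
  have h1 : K ^ (j + 1) ≤ K ^ m := pow_le_pow_right₀ hK.le hjm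
  have h2 : 0 < K ^ l := pow_pos (by linarith) l
  have h3 : K ^ l ≤ K * K ^ l := le_mul_of_one_le_left h2.le hK.le
  rw [pow_succ] at h1
  linarith

theorem exists_large_ratio {X : Type*} [PartialOrder X] [Finite X] {h : X → ℝ}
    (hh : StrictMono h) :
    ∃ K : ℝ, 1 < K ∧ ∀ x y u v : X, x < y → 3 * |h v - h u| ≤ K * (h y - h x) := by
  obtain ⟨M, hM⟩ := (Set.finite_range fun q : X × X × X × X =>
    3 * |h q.2.2.2 - h q.2.2.1| / (h q.2.1 - h q.1)).bddAbove
  refine ⟨max M 2, lt_max_of_lt_right one_lt_two, fun x y u v hxy => ?_⟩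
  have hpos : 0 < h y - h x := sub_pos.2 (hh hxy)
  have hle : 3 * |h v - h u| / (h y - h x) ≤ M := hM ⟨(x, y, u, v), rfl⟩
  exact (div_le_iff₀ hpos).1 (hle.trans (le_max_left _ _))

section Heights

variable {X : Type*} [PartialOrder X] {R : OrderedRealizer X} {h : X → ℝ} {K : ℝ}

theorem edgeHeight_left (u v : X) : R.edgeHeight h K u v (K ^ R.level u) = h u := by
  simp [edgeHeight]

theorem edgeHeight_right (hK : 1 < K) {u v : X} (huv : R.level u < R.level v) :
    R.edgeHeight h K u v (K ^ R.level v) = h v := by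
  have : K ^ R.level v - K ^ R.level u ≠ 0 :=
    (sub_pos.2 (pow_right_strictMono₀ hK huv)).ne'
  rw [edgeHeight, mul_div_cancel₀ _ this]
  ring

theorem mem_segment_of_level_lt (hK : 1 < K) {u v : X} (huv : R.level u < R.level v) {p : ℝ × ℝ}
    (hp : p ∈ segment ℝ (R.chainPos h K u) (R.chainPos h K v)) :
    K ^ R.level u ≤ p.1 ∧ p.1 ≤ K ^ R.level v ∧ p.2 = R.edgeHeight h K u v p.1 := by
  have hpos : 0 < K ^ R.level v - K ^ R.level u := sub_pos.2 (pow_right_strictMono₀ hK huv)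
  obtain ⟨a, b, ha, hb, hab, rfl⟩ := hp
  obtain rfl : a = 1 - b := by linarith
  simp only [chainPos, edgeHeight, Prod.fst_add, Prod.smul_fst, Prod.snd_add, Prod.smul_snd,
    smul_eq_mul]
  refine ⟨by nlinarith, by nlinarith, ?_⟩
  field_simp
  ring

theorem mem_segment_of_level_eq (hh : StrictMono h) {a b : X} (hl : R.level a = R.level b)
    (hab : a < b) {p : ℝ × ℝ} (hp : p ∈ segment ℝ (R.chainPos h K a) (R.chainPos h K b)) :
    p.1 = K ^ R.level a ∧ h a ≤ p.2 ∧ p.2 ≤ h b := by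
  have := hh hab
  obtain ⟨s, t, hs, ht, hst, rfl⟩ := hp
  obtain rfl : s = 1 - t := by linarith
  simp only [chainPos, Prod.fst_add, Prod.smul_fst, Prod.snd_add, Prod.smul_snd, smul_eq_mul, hl]
  exact ⟨by ring, by nlinarith, by nlinarith⟩

/-- On the chain lines before that of its right end, an edge stays close to the height of its left
end. -/
theorem abs_edgeHeight_sub_le (hK : 1 < K)
    (hgap : ∀ x y u v : X, x < y → 3 * |h v - h u| ≤ K * (h y - h x)) {u v x y : X} {j : ℕ}
    (h1 : R.level u ≤ j) (h2 : j < R.level v) (hxy : x < y) :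
    3 * |R.edgeHeight h K u v (K ^ j) - h u| ≤ h y - h x := by
  have hpos : 0 < K ^ R.level v - K ^ R.level u :=
    sub_pos.2 (pow_right_strictMono₀ hK (h1.trans_lt h2))
  have hnn : 0 ≤ K ^ j - K ^ R.level u := sub_nonneg.2 (pow_le_pow_right₀ hK.le h1)
  have hr := mul_pow_sub_pow_le hK (l := R.level u) h2
  have hg := hgap x y u v hxy
  have hK0 : 0 < K := by linarith
  have hgnn : 0 ≤ h y - h x :=
    nonneg_of_mul_nonneg_right ((by positivity : 0 ≤ 3 * |h v - h u|).trans hg) hK0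
  rw [edgeHeight, add_sub_cancel_left, abs_mul, abs_div, abs_of_pos hpos, abs_of_nonneg hnn,
    ← mul_div_assoc, ← mul_div_assoc, div_le_iff₀ hpos]
  calc 3 * ((K ^ j - K ^ R.level u) * |h v - h u|)
      = (K ^ j - K ^ R.level u) * (3 * |h v - h u|) := by ring
    _ ≤ (K ^ j - K ^ R.level u) * (K * (h y - h x)) := mul_le_mul_of_nonneg_left hg hnn
    _ = (K * (K ^ j - K ^ R.level u)) * (h y - h x) := by ring
    _ ≤ (K ^ R.level v - K ^ R.level u) * (h y - h x) := mul_le_mul_of_nonneg_right hr hgnn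
    _ = _ := by ring

theorem lt_edgeHeight (hh : StrictMono h) (hK : 1 < K)
    (hgap : ∀ x y u v : X, x < y → 3 * |h v - h u| ≤ K * (h y - h x)) {u v z : X} {j : ℕ}
    (h1 : R.level u ≤ j) (h2 : j < R.level v) (hz : z < u) :
    h z < R.edgeHeight h K u v (K ^ j) := by
  have hd := abs_edgeHeight_sub_le hK hgap h1 h2 hz
  have := neg_abs_le (R.edgeHeight h K u v (K ^ j) - h u)
  have := hh hz
  linarith

theorem edgeHeight_lt (hh : StrictMono h) (hK : 1 < K)
    (hgap : ∀ x y u v : X, x < y → 3 * |h v - h u| ≤ K * (h y - h x)) {u v z : X} {j : ℕ}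
    (h1 : R.level u ≤ j) (h2 : j < R.level v) (hz : u < z) :
    R.edgeHeight h K u v (K ^ j) < h z := by
  have hd := abs_edgeHeight_sub_le hK hgap h1 h2 hz
  have := le_abs_self (R.edgeHeight h K u v (K ^ j) - h u)
  have := hh hz
  linarith

theorem edgeHeight_lt_edgeHeight (hh : StrictMono h) (hK : 1 < K)
    (hgap : ∀ x y u v : X, x < y → 3 * |h v - h u| ≤ K * (h y - h x)) {u v u' v' : X} {j : ℕ}
    (h1 : R.level u ≤ j) (h2 : j < R.level v) (h1' : R.level u' ≤ j) (h2' : j < R.level v')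
    (hu : u < u') : R.edgeHeight h K u v (K ^ j) < R.edgeHeight h K u' v' (K ^ j) := by
  have hd := abs_edgeHeight_sub_le hK hgap h1 h2 hu
  have hd' := abs_edgeHeight_sub_le hK hgap h1' h2' hu
  have := le_abs_self (R.edgeHeight h K u v (K ^ j) - h u)
  have := neg_abs_le (R.edgeHeight h K u' v' (K ^ j) - h u')
  have := hh hu
  linarith

/-- Two edges that are in the same vertical order at the beginning and, strictly, at the end of
their common range can only meet in a common left end. -/
theorem eq_of_edges_meet (hh : StrictMono h) (hK : 1 < K)
    (hgap : ∀ x y u v : X, x < y → 3 * |h v - h u| ≤ K * (h y - h x)) {u v u' v' : X} {t x : ℝ}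
    (h1 : R.level u < R.level v) (h2 : R.level u' < R.level v) (h3 : R.level u < R.level v')
    (h4 : R.level u' < R.level v') (huu : u ≤ u')
    (ht : R.edgeHeight h K u v t < R.edgeHeight h K u' v' t)
    (hxu : K ^ R.level u ≤ x) (hxu' : K ^ R.level u' ≤ x) (hxt : x ≤ t)
    (hx : R.edgeHeight h K u v x = R.edgeHeight h K u' v' x) :
    u = u' ∧ x = K ^ R.level u := by
  have hs : K ^ max (R.level u) (R.level u') ≤ x := by
    rcases max_choice (R.level u) (R.level u') with h | h <;> rw [h] <;> assumption
  rcases huu.eq_or_lt with rfl | hlt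
  · refine ⟨rfl, eq_left_of_affine_eq (fun _ => rfl) (fun _ => rfl) hxu hxt (le_of_eq ?_) ht hx⟩
    exact (edgeHeight_left u v).trans (edgeHeight_left u v').symm
  · have hstart := edgeHeight_lt_edgeHeight hh hK hgap (le_max_left (R.level u) (R.level u'))
      (max_lt h1 h2) (le_max_right _ _) (max_lt h3 h4) hlt
    have hxs := eq_left_of_affine_eq (fun _ => rfl) (fun _ => rfl) hs hxt hstart.le ht hx
    rw [hxs] at hx
    exact (hstart.ne hx).elim

end Heights

/-! ### The drawing is plane -/

section Drawing

variable {X : Type*} [Lattice X] [Finite X] {R : OrderedRealizer X} {h : X → ℝ} {K : ℝ}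

theorem chainPos_injective (hh : StrictMono h) (hK : 1 < K) :
    Function.Injective (R.chainPos h K) := by
  intro x y hxy
  have h1 : K ^ R.level x = K ^ R.level y := congrArg Prod.fst hxy
  have h2 : h x = h y := congrArg Prod.snd hxy
  rcases eq_or_lt_or_lt_of_level_eq ((pow_right_strictMono₀ hK).injective h1) with h | h | h
  · exact h
  · exact ((hh h).ne h2).elim
  · exact ((hh h).ne' h2).elim

/-- Two segments with a common end that go up and down from it meet in this end only. -/
theorem eq_of_mem_segment_of_lt_of_lt {a b c p : ℝ × ℝ} (hab : a.2 < b.2) (hbc : b.2 < c.2)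
    (hp : p ∈ segment ℝ a b) (hp' : p ∈ segment ℝ c b) : p = b := by
  obtain ⟨s, t, hs, ht, hst, rfl⟩ := hp
  obtain ⟨s', t', hs', ht', hst', he⟩ := hp'
  have he2 := congrArg Prod.snd he
  simp only [Prod.snd_add, Prod.smul_snd, smul_eq_mul] at he2
  obtain rfl : t = 1 - s := by linarith
  obtain rfl : t' = 1 - s' := by linarith
  have h1 : 0 ≤ s' * (c.2 - b.2) := mul_nonneg hs' (sub_pos.2 hbc).le
  have h2 : s * (b.2 - a.2) ≤ 0 := by linarith
  obtain rfl : s = 0 :=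
    le_antisymm (nonpos_of_mul_nonpos_left h2 (sub_pos.2 hab)) hs
  simp

theorem eq_or_eq_of_mem_segment (hh : StrictMono h) (hK : 1 < K)
    (hgap : ∀ x y u v : X, x < y → 3 * |h v - h u| ≤ K * (h y - h x)) {u v z : X}
    (huv : u ⋖ v ∨ v ⋖ u) (hle : R.level u ≤ R.level v)
    (hz : R.chainPos h K z ∈ segment ℝ (R.chainPos h K u) (R.chainPos h K v)) :
    z = u ∨ z = v := by
  have hmono := pow_right_strictMono₀ hK
  rcases hle.lt_or_eq with hlt | hl
  · obtain ⟨hxu, hxv, hy⟩ := mem_segment_of_level_lt hK hlt hz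
    have hlu : R.level u ≤ R.level z := hmono.le_iff_le.1 hxu
    change h z = R.edgeHeight h K u v (K ^ R.level z) at hy
    rcases (hmono.le_iff_le.1 hxv).lt_or_eq with hlv | hlv
    · rcases lt_or_lt_of_edge huv hlu hlv with h1 | h1 | h1
      · exact Or.inl h1
      · exact ((lt_edgeHeight hh hK hgap hlu hlv h1).ne hy).elim
      · exact ((edgeHeight_lt hh hK hgap hlu hlv h1).ne' hy).elim
    · rw [hlv, edgeHeight_right hK hlt] at hy
      rcases eq_or_lt_or_lt_of_level_eq hlv with h1 | h1 | h1
      · exact Or.inr h1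
      · exact ((hh h1).ne hy).elim
      · exact ((hh h1).ne' hy).elim
  · have vertical : ∀ {a b : X}, a ⋖ b → R.level a = R.level b →
        R.chainPos h K z ∈ segment ℝ (R.chainPos h K a) (R.chainPos h K b) → z = a ∨ z = b := by
      intro a b hab hl hz
      obtain ⟨hx, hya, hyb⟩ := mem_segment_of_level_eq hh hl hab.1 hz
      have hza : R.level z = R.level a := hmono.injective hx
      rcases eq_or_lt_or_lt_of_level_eq hza with h1 | h1 | h1
      · exact Or.inl h1
      · exact (hya.not_gt (hh h1)).elim
      rcases eq_or_lt_or_lt_of_level_eq (hza.trans hl) with h2 | h2 | h2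
      · exact Or.inr h2
      · exact (hab.2 h1 h2).elim
      · exact (hyb.not_gt (hh h2)).elim
    rcases huv with huv | huv
    · exact vertical huv hl hz
    · exact (vertical huv hl.symm (by rwa [segment_symm])).symm

theorem meet_vertical_slanted (hh : StrictMono h) (hK : 1 < K)
    (hgap : ∀ x y u v : X, x < y → 3 * |h v - h u| ≤ K * (h y - h x)) {a b u v : X}
    (hab : a ⋖ b) (hl : R.level a = R.level b) (huv : u ⋖ v ∨ v ⋖ u)
    (hlt : R.level u < R.level v) {p : ℝ × ℝ}
    (hp : p ∈ segment ℝ (R.chainPos h K a) (R.chainPos h K b))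
    (hp' : p ∈ segment ℝ (R.chainPos h K u) (R.chainPos h K v)) :
    ∃ w, (w = a ∨ w = b) ∧ (w = u ∨ w = v) ∧ R.chainPos h K w = p := by
  obtain ⟨hx, hya, hyb⟩ := mem_segment_of_level_eq hh hl hab.1 hp
  obtain ⟨hxu, hxv, hy⟩ := mem_segment_of_level_lt hK hlt hp'
  have hmono := pow_right_strictMono₀ hK
  rw [hx] at hxu hxv hy
  have hlu : R.level u ≤ R.level a := hmono.le_iff_le.1 hxu
  rcases (hmono.le_iff_le.1 hxv).lt_or_eq with hlv | hlv
  · have hu : u = a ∨ u = b := by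
      rcases lt_or_lt_of_edge huv hlu hlv with h1 | h1 | h1
      · exact Or.inl h1.symm
      · rcases lt_or_lt_of_edge huv (hl ▸ hlu) (hl ▸ hlv) with h2 | h2 | h2
        · exact Or.inr h2.symm
        · exact (hyb.not_gt (hy ▸ lt_edgeHeight hh hK hgap hlu hlv h2)).elim
        · exact (hab.2 h1 h2).elim
      · exact (hya.not_gt (hy ▸ edgeHeight_lt hh hK hgap hlu hlv h1)).elim
    have hlu' : R.level a = R.level u := by
      rcases hu with rfl | rfl
      · rfl
      · exact hl
    refine ⟨u, hu, Or.inl rfl, Prod.ext ?_ ?_⟩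
    · exact (hlu' ▸ hx).symm
    · rw [hy, hlu', edgeHeight_left]
      rfl
  · rw [hlv, edgeHeight_right hK hlt] at hy
    have hv : v = a ∨ v = b := by
      rcases eq_or_lt_or_lt_of_level_eq hlv with h1 | h1 | h1
      · exact Or.inl h1.symm
      · rcases eq_or_lt_or_lt_of_level_eq (hl ▸ hlv) with h2 | h2 | h2
        · exact Or.inr h2.symm
        · exact (hyb.not_gt (hy ▸ hh h2)).elim
        · exact (hab.2 h1 h2).elim
      · exact (hya.not_gt (hy ▸ hh h1)).elim
    refine ⟨v, hv, Or.inr rfl, Prod.ext ?_ hy.symm⟩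
    exact (hlv ▸ hx).symm

theorem meet_vertical_vertical (hh : StrictMono h) (hK : 1 < K) {a b c d : X}
    (hab : a ⋖ b) (hl : R.level a = R.level b) (hcd : c ⋖ d) (hl' : R.level c = R.level d)
    (hne : (a, b) ≠ (c, d)) {p : ℝ × ℝ}
    (hp : p ∈ segment ℝ (R.chainPos h K a) (R.chainPos h K b))
    (hp' : p ∈ segment ℝ (R.chainPos h K c) (R.chainPos h K d)) :
    ∃ w, (w = a ∨ w = b) ∧ (w = c ∨ w = d) ∧ R.chainPos h K w = p := by
  obtain ⟨hx, hya, hyb⟩ := mem_segment_of_level_eq hh hl hab.1 hp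
  obtain ⟨hx', hyc, hyd⟩ := mem_segment_of_level_eq hh hl' hcd.1 hp'
  have hac : R.level a = R.level c := (pow_right_strictMono₀ hK).injective (hx.symm.trans hx')
  rcases eq_or_lt_or_lt_of_level_eq (hl.symm.trans hac) with rfl | h1 | h1
  · exact ⟨b, Or.inr rfl, Or.inl rfl, Prod.ext hx'.symm (le_antisymm hyc hyb)⟩
  · exact (((hyc.trans hyb).not_gt (hh h1))).elim
  rcases eq_or_lt_or_lt_of_level_eq (hac.trans hl') with rfl | h2 | h2
  · exact ⟨a, Or.inl rfl, Or.inr rfl, Prod.ext hx.symm (le_antisymm hya hyd)⟩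
  · rcases eq_or_lt_or_lt_of_level_eq hac with rfl | h3 | h3
    · rcases eq_or_lt_or_lt_of_level_eq (hl.symm.trans hl') with rfl | h4 | h4
      · exact (hne rfl).elim
      · exact (hcd.2 hab.1 h4).elim
      · exact (hab.2 hcd.1 h4).elim
    · exact (hab.2 h3 h1).elim
    · exact (hcd.2 h3 h2).elim
  · exact (((hya.trans hyd).not_gt (hh h2))).elim

theorem meet_slanted_slanted_of_le (hh : StrictMono h) (hK : 1 < K)
    (hgap : ∀ x y u v : X, x < y → 3 * |h v - h u| ≤ K * (h y - h x)) {u v u' v' : X}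
    (huv : u ⋖ v ∨ v ⋖ u) (hlt : R.level u < R.level v)
    (huv' : u' ⋖ v' ∨ v' ⋖ u') (hlt' : R.level u' < R.level v')
    (hle : R.level v ≤ R.level v') (hne : ¬ (u = u' ∧ v = v')) {p : ℝ × ℝ}
    (hp : p ∈ segment ℝ (R.chainPos h K u) (R.chainPos h K v))
    (hp' : p ∈ segment ℝ (R.chainPos h K u') (R.chainPos h K v')) :
    ∃ w, (w = u ∨ w = v) ∧ (w = u' ∨ w = v') ∧ R.chainPos h K w = p := by
  obtain ⟨hxu, hxv, hy⟩ := mem_segment_of_level_lt hK hlt hp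
  obtain ⟨hxu', hxv', hy'⟩ := mem_segment_of_level_lt hK hlt' hp'
  have hmono := pow_right_strictMono₀ hK
  have hlu'v : R.level u' ≤ R.level v := hmono.le_iff_le.1 (hxu'.trans hxv)
  rcases hlu'v.lt_or_eq with hu'v | hu'v
  swap
  · -- the ranges of the two edges share the line of `v` and `u'` only
    have hx : p.1 = K ^ R.level v := le_antisymm hxv (hu'v ▸ hxu')
    have e1 : R.chainPos h K v = p := by
      refine Prod.ext hx.symm ?_
      rw [hy, hx, edgeHeight_right hK hlt]
      rfl
    have e2 : R.chainPos h K u' = p := by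
      rw [← hu'v] at hx
      refine Prod.ext hx.symm ?_
      rw [hy', hx, edgeHeight_left]
      rfl
    exact ⟨v, Or.inr rfl, Or.inl (chainPos_injective hh hK (e1.trans e2.symm)), e1⟩
  have huv'lt := hlt.trans_le hle
  have hx : R.edgeHeight h K u v p.1 = R.edgeHeight h K u' v' p.1 := hy.symm.trans hy'
  have below : u ≤ u' →
      R.edgeHeight h K u v (K ^ R.level v) < R.edgeHeight h K u' v' (K ^ R.level v) →
      ∃ w, (w = u ∨ w = v) ∧ (w = u' ∨ w = v') ∧ R.chainPos h K w = p := by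
    intro huu ht
    obtain ⟨e, hpx⟩ := eq_of_edges_meet hh hK hgap hlt hu'v huv'lt hlt' huu ht hxu hxu' hxv hx
    refine ⟨u, Or.inl rfl, Or.inl e, Prod.ext hpx.symm ?_⟩
    rw [hy, hpx, edgeHeight_left]
    rfl
  have above : u' ≤ u →
      R.edgeHeight h K u' v' (K ^ R.level v) < R.edgeHeight h K u v (K ^ R.level v) →
      ∃ w, (w = u ∨ w = v) ∧ (w = u' ∨ w = v') ∧ R.chainPos h K w = p := by
    intro huu ht
    obtain ⟨e, hpx⟩ :=
      eq_of_edges_meet hh hK hgap hlt' huv'lt hu'v hlt huu ht hxu' hxu hxv hx.symm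
    refine ⟨u', Or.inl e, Or.inl rfl, Prod.ext hpx.symm ?_⟩
    rw [hy', hpx, edgeHeight_left]
    rfl
  have hv := edgeHeight_right (h := h) hK hlt
  rcases hle.lt_or_eq with hvv | hvv
  · rcases edge_above_or_below huv huv' hlt hvv hu'v with ⟨h1, h2⟩ | ⟨h1, h2⟩
    · exact below h2 (hv ▸ lt_edgeHeight hh hK hgap hu'v.le hvv h1)
    · exact above h2 (hv ▸ edgeHeight_lt hh hK hgap hu'v.le hvv h1)
  have hv' : R.edgeHeight h K u' v' (K ^ R.level v) = h v' := by
    rw [hvv, edgeHeight_right hK hlt']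
  rcases eq_or_lt_or_lt_of_level_eq hvv with rfl | h1 | h1
  · -- one of the edges goes up to the common right end, and the other one goes down to it
    refine ⟨v, Or.inr rfl, Or.inr rfl, Eq.symm ?_⟩
    rcases lt_or_lt_of_edge_of_edge huv huv' hu'v huv'lt with h1 | h1 | h1
    · exact (hne ⟨h1, rfl⟩).elim
    · have hu : u < v := huv.elim (fun e => e.1) fun e =>
        huv'.elim (fun e' => (e'.1.trans (e.1.trans h1)).false.elim) fun e' => (e'.2 e.1 h1).elim
      have hu' : v < u' := huv'.elim (fun e' =>
        huv.elim (fun e => (e.2 h1 e'.1).elim) fun e => (e.1.trans (h1.trans e'.1)).false.elim)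
        fun e' => e'.1
      exact eq_of_mem_segment_of_lt_of_lt (a := R.chainPos h K u) (c := R.chainPos h K u')
        (hh hu) (hh hu') hp hp'
    · have hu' : u' < v := huv'.elim (fun e => e.1) fun e =>
        huv.elim (fun e' => (e'.1.trans (e.1.trans h1)).false.elim) fun e' => (e'.2 e.1 h1).elim
      have hu : v < u := huv.elim (fun e' =>
        huv'.elim (fun e => (e.2 h1 e'.1).elim) fun e => (e.1.trans (h1.trans e'.1)).false.elim)
        fun e' => e'.1
      exact eq_of_mem_segment_of_lt_of_lt (a := R.chainPos h K u') (c := R.chainPos h K u)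
        (hh hu') (hh hu) hp' hp
  · exact below (le_of_edge_of_edge huv huv' hlt hlt' hvv h1) (by rw [hv, hv']; exact hh h1)
  · exact above (le_of_edge_of_edge huv' huv hlt' hlt hvv.symm h1) (by rw [hv, hv']; exact hh h1)

theorem meet_slanted_slanted (hh : StrictMono h) (hK : 1 < K)
    (hgap : ∀ x y u v : X, x < y → 3 * |h v - h u| ≤ K * (h y - h x)) {u v u' v' : X}
    (huv : u ⋖ v ∨ v ⋖ u) (hlt : R.level u < R.level v)
    (huv' : u' ⋖ v' ∨ v' ⋖ u') (hlt' : R.level u' < R.level v')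
    (hne : ¬ (u = u' ∧ v = v')) {p : ℝ × ℝ}
    (hp : p ∈ segment ℝ (R.chainPos h K u) (R.chainPos h K v))
    (hp' : p ∈ segment ℝ (R.chainPos h K u') (R.chainPos h K v')) :
    ∃ w, (w = u ∨ w = v) ∧ (w = u' ∨ w = v') ∧ R.chainPos h K w = p := by
  rcases le_total (R.level v) (R.level v') with hle | hle
  · exact meet_slanted_slanted_of_le hh hK hgap huv hlt huv' hlt' hle hne hp hp'
  · obtain ⟨w, h1, h2, h3⟩ := meet_slanted_slanted_of_le hh hK hgap huv' hlt' huv hlt hle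
      (fun e => hne ⟨e.1.symm, e.2.symm⟩) hp' hp
    exact ⟨w, h2, h1, h3⟩

/-- A slanted edge, directed from left to right, meets a different edge in a common end only. -/
theorem meet_slanted_edge (hh : StrictMono h) (hK : 1 < K)
    (hgap : ∀ x y u v : X, x < y → 3 * |h v - h u| ≤ K * (h y - h x)) {u v c d : X}
    (huv : u ⋖ v ∨ v ⋖ u) (hlt : R.level u < R.level v) (hcd : c ⋖ d)
    (hne : ¬ (u = c ∧ v = d)) (hne' : ¬ (u = d ∧ v = c)) {p : ℝ × ℝ}
    (hp : p ∈ segment ℝ (R.chainPos h K u) (R.chainPos h K v))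
    (hp' : p ∈ segment ℝ (R.chainPos h K c) (R.chainPos h K d)) :
    ∃ w, (w = u ∨ w = v) ∧ (w = c ∨ w = d) ∧ R.chainPos h K w = p := by
  rcases lt_trichotomy (R.level c) (R.level d) with hl | hl | hl
  · exact meet_slanted_slanted hh hK hgap huv hlt (Or.inl hcd) hl hne hp hp'
  · obtain ⟨w, h1, h2, h3⟩ := meet_vertical_slanted hh hK hgap hcd hl huv hlt hp' hp
    exact ⟨w, h2, h1, h3⟩
  · obtain ⟨w, h1, h2, h3⟩ := meet_slanted_slanted hh hK hgap huv hlt (Or.inr hcd) hl hne' hp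
      (by rwa [segment_symm])
    exact ⟨w, h1, h2.symm, h3⟩

theorem meet_edge_edge (hh : StrictMono h) (hK : 1 < K)
    (hgap : ∀ x y u v : X, x < y → 3 * |h v - h u| ≤ K * (h y - h x)) {a b c d : X}
    (hab : a ⋖ b) (hcd : c ⋖ d) (hne : (a, b) ≠ (c, d)) {p : ℝ × ℝ}
    (hp : p ∈ segment ℝ (R.chainPos h K a) (R.chainPos h K b))
    (hp' : p ∈ segment ℝ (R.chainPos h K c) (R.chainPos h K d)) :
    ∃ w, (w = a ∨ w = b) ∧ (w = c ∨ w = d) ∧ R.chainPos h K w = p := by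
  have hne1 : ¬ (a = c ∧ b = d) := fun e => hne (Prod.ext e.1 e.2)
  have hne2 : ¬ (a = d ∧ b = c) := by
    rintro ⟨rfl, rfl⟩
    exact hab.1.not_gt hcd.1
  rcases lt_trichotomy (R.level a) (R.level b) with hl | hl | hl
  · exact meet_slanted_edge hh hK hgap (Or.inl hab) hl hcd hne1 hne2 hp hp'
  · rcases lt_trichotomy (R.level c) (R.level d) with hl' | hl' | hl'
    · exact meet_vertical_slanted hh hK hgap hab hl (Or.inl hcd) hl' hp hp'
    · exact meet_vertical_vertical hh hK hab hl hcd hl' hne hp hp'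
    · obtain ⟨w, h1, h2, h3⟩ := meet_vertical_slanted hh hK hgap hab hl (Or.inr hcd) hl' hp
        (by rwa [segment_symm])
      exact ⟨w, h1, h2.symm, h3⟩
  · obtain ⟨w, h1, h2, h3⟩ := meet_slanted_edge hh hK hgap (Or.inr hab) hl hcd
      (fun e => hne2 e.symm) (fun e => hne1 e.symm) (by rwa [segment_symm]) hp'
    exact ⟨w, h1.symm, h2, h3⟩

theorem isPlaneStraightLineDiagram_chainPos (hh : StrictMono h) (hK : 1 < K)
    (hgap : ∀ x y u v : X, x < y → 3 * |h v - h u| ≤ K * (h y - h x)) :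
    IsPlaneStraightLineDiagram (R.chainPos h K) where
  injective := chainPos_injective hh hK
  upward _ _ hxy := hh hxy.1
  vertex_on_edge x y z hxy hz := by
    rcases le_total (R.level x) (R.level y) with hl | hl
    · exact eq_or_eq_of_mem_segment hh hK hgap (Or.inl hxy) hl hz
    · exact (eq_or_eq_of_mem_segment hh hK hgap (Or.inr hxy) hl (by rwa [segment_symm])).symm
  noncrossing a b c d hab hcd hne p hp := by
    obtain ⟨w, h1, h2, h3⟩ := meet_edge_edge hh hK hgap hab hcd hne hp.1 hp.2
    exact ⟨w, ⟨h1, h2⟩, h3⟩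

/-! ### The embedding -/

/-- Of two edges that go to the right from a point of the chain with index `i`, the one that ends
on the earlier chain is the steeper one. Here `k` and `l` are the heights of the edges that end on
the chains with indices `m` and `n`. -/
theorem displacement_lt_displacement {K k l : ℝ} (hK : 1 < K) {i m n : ℕ} (him : i < m)
    (hmn : m < n) (hk : 0 < k) (hkl : 3 * l ≤ K * k) :
    (K ^ m - K ^ i) * l < (K ^ n - K ^ i) * k := by
  have hmono := pow_right_strictMono₀ hK
  have h1 : 0 < K ^ m - K ^ i := sub_pos.2 (hmono him)
  have h2 : 0 < (K ^ n - K ^ i) * k := mul_pos (sub_pos.2 (hmono (him.trans hmn))) hk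
  have h3 := mul_le_mul_of_nonneg_right (mul_pow_sub_pow_le hK (l := i) hmn) hk.le
  have h4 := mul_le_mul_of_nonneg_left hkl h1.le
  linarith

/-- Edges from `x` to `y` and `z`, both upwards or both downwards, with heights `k` and `l`. They
cannot both go to an earlier chain than that of `x`, by `not_conjLT_of_edge`; if both go to a later
chain, the first one is the steeper one. -/
theorem displacement_lt_of_conjLT (hK : 1 < K) {x y z : X} (hyz : R.conjLT y z)
    (hxy : y ⋖ x ∨ x ⋖ y) {k l : ℝ} (hk : 0 < k) (hl : 0 < l) (hkl : 3 * l ≤ K * k) :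
    (K ^ R.level y - K ^ R.level x) * l < (K ^ R.level z - K ^ R.level x) * k := by
  have hmono := pow_right_strictMono₀ hK
  have hlt := level_lt hyz
  rcases lt_or_ge (R.level x) (R.level y) with h1 | h1
  · exact displacement_lt_displacement hK h1 hlt hk hkl
  have h2 : R.level x ≤ R.level z := by
    by_contra hzx
    exact not_conjLT_of_edge hxy (hlt.trans (not_le.1 hzx)) (not_le.1 hzx) hyz
  have h3 : (K ^ R.level y - K ^ R.level x) * l ≤ 0 :=
    mul_nonpos_of_nonpos_of_nonneg (sub_nonpos.2 (hmono.monotone h1)) hl.le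
  have h4 : 0 ≤ (K ^ R.level z - K ^ R.level x) * k :=
    mul_nonneg (sub_nonneg.2 (hmono.monotone h2)) hk.le
  rcases h1.lt_or_eq with h5 | h5
  · exact (mul_neg_of_neg_of_pos (sub_neg.2 (hmono h5)) hl).trans_le h4
  · exact h3.trans_lt (mul_pos (sub_pos.2 (hmono (h5 ▸ hlt))) hk)

theorem respectsEmbedding_chainPos (hh : StrictMono h) (hK : 1 < K)
    (hgap : ∀ x y u v : X, x < y → 3 * |h v - h u| ≤ K * (h y - h x)) :
    RespectsEmbedding R (R.chainPos h K) where
  upper x y z hxy hxz hyz := by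
    have hl := le_abs_self (h z - h x)
    have := hgap x y x z hxy.1
    refine displacement_lt_of_conjLT hK hyz.2.2 (Or.inr hxy) (sub_pos.2 (hh hxy.1))
      (sub_pos.2 (hh hxz.1)) ?_
    change 3 * (h z - h x) ≤ K * (h y - h x)
    linarith
  lower x y z hyx hzx hyz := by
    have hl := le_abs_self (h x - h z)
    have := hgap y x z x hyx.1
    refine displacement_lt_of_conjLT hK hyz.2.2 (Or.inl hyx) (sub_pos.2 (hh hyx.1))
      (sub_pos.2 (hh hzx.1)) ?_
    change 3 * (h x - h z) ≤ K * (h x - h y)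
    linarith

end Drawing

end OrderedRealizer

/-- A plane drawing restricts to a plane drawing of a suborder whose covers are covers. -/
theorem IsPlaneStraightLineDiagram.restrict {X : Type*} [PartialOrder X] {pos : X → ℝ × ℝ}
    (hpos : IsPlaneStraightLineDiagram pos) {s : Set X}
    (hs : ∀ a b : s, a ⋖ b → (a : X) ⋖ (b : X)) :
    IsPlaneStraightLineDiagram fun x : s => pos x where
  injective := hpos.injective.comp Subtype.val_injective
  upward x y hxy := hpos.upward x y (hs x y hxy)
  vertex_on_edge x y z hxy hz :=
    (hpos.vertex_on_edge x y z (hs x y hxy) hz).imp Subtype.ext Subtype.ext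
  noncrossing a b c d hab hcd hne p hp := by
    have hne' : ((a : X), (b : X)) ≠ ((c : X), (d : X)) := fun e =>
      hne (Prod.ext (Subtype.ext (Prod.ext_iff.1 e).1) (Subtype.ext (Prod.ext_iff.1 e).2))
    obtain ⟨w, ⟨h1, h2⟩, rfl⟩ := hpos.noncrossing a b c d (hs a b hab) (hs c d hcd) hne' hp
    have hw : w ∈ s := by
      rcases h1 with rfl | rfl
      · exact a.2
      · exact b.2
    exact ⟨⟨w, hw⟩, ⟨h1.imp Subtype.ext Subtype.ext, h2.imp Subtype.ext Subtype.ext⟩, rfl⟩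

theorem mainTheorem4 {X : Type*} [Lattice X] [Finite X] (R : OrderedRealizer X)
    (h : X → ℝ) (hh : StrictMono h) :
    ∃ pos : X → ℝ × ℝ,
      -- a plane straight-line drawing of the diagram, with the plane embedding fixed by `R`
      IsPlaneStraightLineDiagram pos ∧ RespectsEmbedding R pos ∧
      -- with the prescribed heights
      (∀ x : X, (pos x).2 = h x) ∧
      -- with the left boundary chain on one vertical line
      (∃ c : ℝ, ∀ x ∈ R.leftBoundary, (pos x).1 = c) ∧
      -- built from left to right by adding the canonical chains, one vertical line for each
      (∃ ξ : ℕ → ℝ, StrictMono ξ ∧ ∀ i : ℕ, ∀ x ∈ R.canonicalChain i, (pos x).1 = ξ i) ∧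
      (∀ i : ℕ, IsPlaneStraightLineDiagram
        (fun x : {x : X // ∃ j < i, x ∈ R.canonicalChain j} => pos x)) := by
  obtain ⟨K, hK, hgap⟩ := OrderedRealizer.exists_large_ratio hh
  have hplane : IsPlaneStraightLineDiagram (R.chainPos h K) :=
    OrderedRealizer.isPlaneStraightLineDiagram_chainPos hh hK hgap
  refine ⟨R.chainPos h K, hplane, OrderedRealizer.respectsEmbedding_chainPos hh hK hgap,
    fun _ => rfl, ⟨K ^ 0, fun x hx => ?_⟩,
    ⟨fun i => K ^ i, pow_right_strictMono₀ hK, fun i x hx => ?_⟩, fun i => ?_⟩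
  · rw [← OrderedRealizer.level_eq_zero_of_mem_leftBoundary hx]
    rfl
  · rw [← R.mem_canonicalChain_iff.1 hx]
    rfl
  · refine hplane.restrict (s := {x | ∃ j < i, x ∈ R.canonicalChain j}) fun a b hab => ?_
    refine OrderedRealizer.covBy_of_covBy_initial (R := R) (n := i) (fun x => ?_) hab
    simp only [Set.mem_ofPred_eq, R.mem_canonicalChain_iff]
    exact ⟨fun ⟨j, hj, hx⟩ => hx ▸ hj, fun hx => ⟨_, hx, rfl⟩⟩
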